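/- For a positive integer $n$, a $B_n$-partition is a set partition $\pi$ of $\{1,2,\dots,n,-1,-2,\dots,-n\}$ such that for every block $B$ of $\pi$ the set $-B=\{-x : x\in B\}$ is also a block of $\pi$, and such that at most one block $B$ of $\pi$, called the zero-block, satisfies $B=-B$. Let $M_n$ be the number of all $B_n$-partitions and let $N_n$ be the number of $B_n$-partitions without zero-block. Then $$\frac{N_n}{M_n}\sim\sqrt{\frac{\log n}{2n}}\qquad (n\to\infty).$$ -/

import Mathlib

open scoped Pointwise

namespace TypeB

/-- The signed ground set `{1, …, n, -1, …, -n}`. -/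
noncomputable def ground (n : ℕ) : Finset ℤ := (Finset.Icc (-(n : ℤ)) (n : ℤ)).erase 0

/-- The block `B` satisfies `B = -B`, where `-B = {-x | x ∈ B}`. -/
def IsZeroBlock (B : Finset ℤ) : Prop := B = -B

/-- A set partition of `{±1, …, ±n}` is of type `B_n` if its set of blocks is closed under
`B ↦ -B` and it has at most one zero-block. (The blocks of a `Finpartition` are nonempty.) -/
def IsBPartition {n : ℕ} (π : Finpartition (ground n)) : Prop :=
  (∀ B ∈ π.parts, -B ∈ π.parts) ∧
    ∀ B ∈ π.parts, ∀ C ∈ π.parts, IsZeroBlock B → IsZeroBlock C → B = C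

/-- The number `M_n` of `B_n`-partitions. -/
noncomputable def M (n : ℕ) : ℕ :=
  Nat.card {π : Finpartition (ground n) // IsBPartition π}

/-- The number `N_n` of `B_n`-partitions without zero-block. -/
noncomputable def N (n : ℕ) : ℕ :=
  Nat.card {π : Finpartition (ground n) //
    IsBPartition π ∧ ∀ B ∈ π.parts, ¬ IsZeroBlock B}

end TypeB

/-! ### Partitions as fibres of odd maps -/

namespace TypeB

/-! A Dobinski-type formula turns both counts into moments. The fibres of an odd map from the ground
set to {-k, …, k} form a `B_n`-partition, whose zero-block, if any, is the fibre over 0. A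
`B_n`-partition with b pairs of blocks B ≠ -B arises from exactly k(k-1)⋯(k-b+1)·2^b such maps
(`card_fibreMaps`), so summing over partitions gives (2k+1)^n, or (2k)^n when there is no
zero-block. If K is Poisson with mean 1/2, that factor has expectation 1. Hence, with X = 2K, M_n =
E(X+1)^n and N_n = E X^n.

The identity E[X p(X)] = E[p(X+2)] (`expect_X_mul`) and Jensen's inequality (`expect_jensen`) then
give two-sided bounds for the ratio q of consecutive moments of X+c, c ∈ {0, 1}: q log q ≈ 2n.
Jensen again, with shifts ±1, gives log(M_n/N_n) ≈ n/q ≈ (log q)/2. All errors are o(1) additively,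
and log q = log(2n) - log log n + o(1), so M_n/N_n is asymptotic to the square root of 2n/log n. -/

lemma mem_ground {n : ℕ} {x : ℤ} : x ∈ ground n ↔ x ≠ 0 ∧ -(n : ℤ) ≤ x ∧ x ≤ n := by
  simp [ground]

lemma neg_mem_ground {n : ℕ} {x : ℤ} (hx : x ∈ ground n) : -x ∈ ground n := by
  rw [mem_ground] at *; omega

/-- The partition `π` is the partition of the ground set into the fibres of `h`. -/
def IsKer {n : ℕ} (π : Finpartition (ground n)) (h : ℤ → ℤ) : Prop :=
  ∀ x ∈ ground n, ∀ y ∈ ground n, h x = h y ↔ π.part x = π.part y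

open Classical in
/-- The partition of the ground set into the fibres of `h`. -/
noncomputable def ker (n : ℕ) (h : ℤ → ℤ) : Finpartition (ground n) :=
  Finpartition.ofSetSetoid (Setoid.ker h) (ground n)

lemma isKer_ker (n : ℕ) (h : ℤ → ℤ) : IsKer (ker n h) h := by
  intro x hx y hy
  rw [← Finpartition.mem_part_iff_part_eq_part _ hx hy, ker,
    Finpartition.mem_part_ofSetSetoid_iff_rel]
  simp only [Setoid.ker_def, hx, hy, true_and]
  exact eq_comm

lemma IsKer.part_eq {n : ℕ} {π : Finpartition (ground n)} {h : ℤ → ℤ} (H : IsKer π h) {x : ℤ}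
    (hx : x ∈ ground n) : π.part x = (ground n).filter (fun y => h y = h x) := by
  ext y
  rw [Finset.mem_filter]
  constructor
  · intro hy
    have hy' := π.part_subset x hy
    exact ⟨hy', (H y hy' x hx).2 ((π.mem_part_iff_part_eq_part hy' hx).1 hy)⟩
  · rintro ⟨hy, e⟩
    exact (π.mem_part_iff_part_eq_part hy hx).2 ((H y hy x hx).1 e)

lemma exists_eq_part {n : ℕ} {π : Finpartition (ground n)} {B : Finset ℤ} (hB : B ∈ π.parts) :
    ∃ x ∈ ground n, x ∈ B ∧ π.part x = B := by
  obtain ⟨x, hx⟩ := π.nonempty_of_mem_parts hB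
  exact ⟨x, π.subset hB hx, hx, π.part_eq_of_mem hB hx⟩

lemma IsKer.unique {n : ℕ} {π ρ : Finpartition (ground n)} {h : ℤ → ℤ} (H : IsKer π h)
    (H' : IsKer ρ h) : π = ρ := by
  ext1
  have key : ∀ π ρ : Finpartition (ground n), IsKer π h → IsKer ρ h → π.parts ⊆ ρ.parts := by
    intro π ρ H H' B hB
    obtain ⟨x, hx, -, rfl⟩ := exists_eq_part hB
    rw [H.part_eq hx, ← H'.part_eq hx]
    exact ρ.part_mem.2 hx
  exact (key _ _ H H').antisymm (key _ _ H' H)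

lemma ker_eq_iff {n : ℕ} {π : Finpartition (ground n)} {h : ℤ → ℤ} : ker n h = π ↔ IsKer π h :=
  ⟨fun e => e ▸ isKer_ker n h, fun H => (isKer_ker n h).unique H⟩

lemma IsKer.neg_part {n : ℕ} {π : Finpartition (ground n)} {h : ℤ → ℤ} (H : IsKer π h)
    (odd : ∀ x, h (-x) = -h x) {x : ℤ} (hx : x ∈ ground n) : -π.part x = π.part (-x) := by
  ext y
  rw [Finset.mem_neg', H.part_eq hx, H.part_eq (neg_mem_ground hx), Finset.mem_filter,
    Finset.mem_filter, odd, odd]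
  refine and_congr ⟨fun h => by simpa using neg_mem_ground h, neg_mem_ground⟩ ?_
  constructor <;> intro e <;> omega

/-- For odd h, the block of x equals its negative iff h x = h (-x) = -h x. So all zero-blocks lie
over the single value 0, which is why at most one exists. -/
lemma IsKer.isZeroBlock_iff {n : ℕ} {π : Finpartition (ground n)} {h : ℤ → ℤ} (H : IsKer π h)
    (odd : ∀ x, h (-x) = -h x) {x : ℤ} (hx : x ∈ ground n) :
    IsZeroBlock (π.part x) ↔ h x = 0 := by
  rw [IsZeroBlock, H.neg_part odd hx, ← H x hx (-x) (neg_mem_ground hx), odd]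
  omega

lemma IsKer.isBPartition {n : ℕ} {π : Finpartition (ground n)} {h : ℤ → ℤ} (H : IsKer π h)
    (odd : ∀ x, h (-x) = -h x) : IsBPartition π := by
  refine ⟨fun B hB => ?_, fun B hB C hC zB zC => ?_⟩
  · obtain ⟨x, hx, -, rfl⟩ := exists_eq_part hB
    rw [H.neg_part odd hx]
    exact π.part_mem.2 (neg_mem_ground hx)
  · obtain ⟨x, hx, -, rfl⟩ := exists_eq_part hB
    obtain ⟨y, hy, -, rfl⟩ := exists_eq_part hC
    rw [H.isZeroBlock_iff odd hx] at zB
    rw [H.isZeroBlock_iff odd hy] at zC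
    rw [← H x hx y hy, zB, zC]

/-- The odd extension to `ℤ` of a map on `{1, …, n}`. -/
def oddExt {n : ℕ} (f : Fin n → ℤ) (x : ℤ) : ℤ :=
  -- The truncated subtraction at x = 0 is harmless, since `sign` vanishes there.
  x.sign * if h : x.natAbs - 1 < n then f ⟨x.natAbs - 1, h⟩ else 0

lemma oddExt_neg {n : ℕ} (f : Fin n → ℤ) (x : ℤ) : oddExt f (-x) = -oddExt f x := by
  unfold oddExt
  rw [Int.sign_neg, Int.natAbs_neg, neg_mul]

lemma oddExt_succ {n : ℕ} (f : Fin n → ℤ) (i : Fin n) : oddExt f ((i : ℤ) + 1) = f i := by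
  have h1 : ((i : ℤ) + 1).sign = 1 := Int.sign_eq_one_of_pos (by omega)
  have h2 : ((i : ℤ) + 1).natAbs - 1 = i := by omega
  simp [oddExt, h1, h2]

lemma succ_mem_ground {n : ℕ} (i : Fin n) : (i : ℤ) + 1 ∈ ground n := by
  rw [mem_ground]; omega

lemma mem_ground_cases {n : ℕ} {x : ℤ} (hx : x ∈ ground n) :
    ∃ i : Fin n, x = (i : ℤ) + 1 ∨ x = -((i : ℤ) + 1) := by
  rw [mem_ground] at hx
  refine ⟨⟨x.natAbs - 1, by omega⟩, ?_⟩
  simp only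
  omega

lemma eq_oddExt {n : ℕ} {h : ℤ → ℤ} (odd : ∀ x ∈ ground n, h (-x) = -h x) {x : ℤ}
    (hx : x ∈ ground n) : oddExt (fun i : Fin n => h ((i : ℤ) + 1)) x = h x := by
  obtain ⟨i, rfl | rfl⟩ := mem_ground_cases hx
  · rw [oddExt_succ]
  · rw [oddExt_neg, oddExt_succ, odd _ (succ_mem_ground i)]

/-- One block out of each pair `B ≠ -B`. -/
noncomputable def halfParts {n : ℕ} (π : Finpartition (ground n)) : Finset (Finset ℤ) :=
  π.parts.filter (fun B => toColex B < toColex (-B))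

/-! ### Counting the odd maps with given fibres -/

section fibre

variable {n k : ℕ} {π : Finpartition (ground n)}

/-- The value on the block `B` that is prescribed by labels and signs of the chosen blocks. -/
noncomputable def blockValue (p : (halfParts π ↪ Fin k) × (halfParts π → ℤˣ))
    (B : Finset ℤ) : ℤ :=
  if h : B ∈ halfParts π then (p.2 ⟨B, h⟩ : ℤ) * ((p.1 ⟨B, h⟩ : ℕ) + 1)
  else if h : -B ∈ halfParts π then -((p.2 ⟨-B, h⟩ : ℤ) * ((p.1 ⟨-B, h⟩ : ℕ) + 1))
  else 0

lemma neg_notMem_halfParts {B : Finset ℤ} (hB : B ∈ halfParts π) : -B ∉ halfParts π := by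
  intro h
  have h1 := (Finset.mem_filter.1 hB).2
  have h2 := (Finset.mem_filter.1 h).2
  rw [neg_neg] at h2
  exact lt_asymm h1 h2

lemma blockValue_neg (p : (halfParts π ↪ Fin k) × (halfParts π → ℤˣ)) (B : Finset ℤ) :
    blockValue p (-B) = -blockValue p B := by
  by_cases h : B ∈ halfParts π
  · have h' := neg_notMem_halfParts h
    simp [blockValue, h, h']
  · by_cases h' : -B ∈ halfParts π <;> simp [blockValue, h, h']

lemma block_cases (hπ : IsBPartition π) {B : Finset ℤ} (hB : B ∈ π.parts) :
    B ∈ halfParts π ∨ -B ∈ halfParts π ∨ IsZeroBlock B := by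
  rcases lt_trichotomy (toColex B) (toColex (-B)) with h | h | h
  · exact Or.inl (Finset.mem_filter.2 ⟨hB, h⟩)
  · exact Or.inr (Or.inr (toColex_inj.1 h))
  · exact Or.inr (Or.inl (Finset.mem_filter.2 ⟨hπ.1 B hB, by rwa [neg_neg]⟩))

lemma unit_mul_inj {s t : ℤˣ} {a b : ℕ} (h : (s : ℤ) * ((a : ℤ) + 1) = t * ((b : ℤ) + 1)) :
    s = t ∧ a = b := by
  rcases Int.units_eq_one_or s with rfl | rfl <;> rcases Int.units_eq_one_or t with rfl | rfl <;>
    simp at h ⊢ <;> omega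

lemma blockValue_of_mem (p : (halfParts π ↪ Fin k) × (halfParts π → ℤˣ)) {B : Finset ℤ}
    (h : B ∈ halfParts π) :
    blockValue p B = (p.2 ⟨B, h⟩ : ℤ) * ((p.1 ⟨B, h⟩ : ℕ) + 1) := by
  simp [blockValue, h]

lemma blockValue_eq_zero_iff (hπ : IsBPartition π)
    (p : (halfParts π ↪ Fin k) × (halfParts π → ℤˣ)) {B : Finset ℤ} (hB : B ∈ π.parts) :
    blockValue p B = 0 ↔ IsZeroBlock B := by
  have key : ∀ C ∈ halfParts π, blockValue p C ≠ 0 := by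
    intro C h
    rw [blockValue_of_mem p h]
    exact mul_ne_zero (Units.ne_zero _) (by positivity)
  constructor
  · intro h
    rcases block_cases hπ hB with h' | h' | h'
    · exact absurd h (key _ h')
    · exact absurd (by rw [blockValue_neg, h, neg_zero]) (key _ h')
    · exact h'
  · intro h
    have := blockValue_neg p B
    rw [← show B = -B from h] at this
    omega

lemma blockValue_inj_aux (p : (halfParts π ↪ Fin k) × (halfParts π → ℤˣ)) {B C : Finset ℤ}
    (hB : B ∈ halfParts π) (hC : C ∈ halfParts π) :
    (blockValue p B = blockValue p C → B = C) ∧ blockValue p B ≠ -blockValue p C := by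
  rw [blockValue_of_mem p hB, blockValue_of_mem p hC]
  constructor
  · intro h
    have := p.1.injective (Fin.ext (unit_mul_inj h).2)
    simpa using this
  · intro h
    rw [← neg_mul, ← Units.val_neg] at h
    obtain ⟨h1, h2⟩ := unit_mul_inj h
    have := p.1.injective (Fin.ext h2)
    rw [this] at h1
    exact units_ne_neg_self _ h1

lemma blockValue_inj (hπ : IsBPartition π) (p : (halfParts π ↪ Fin k) × (halfParts π → ℤˣ))
    {B C : Finset ℤ} (hB : B ∈ π.parts) (hC : C ∈ π.parts)
    (h : blockValue p B = blockValue p C) : B = C := by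
  have hn := blockValue_neg p B
  have hn' := blockValue_neg p C
  rcases block_cases hπ hB with hB' | hB' | hB'
  · rcases block_cases hπ hC with hC' | hC' | hC'
    · exact (blockValue_inj_aux p hB' hC').1 h
    · exact absurd (by rw [hn', neg_neg, h]) (blockValue_inj_aux p hB' hC').2
    · rw [← blockValue_eq_zero_iff hπ p hC, ← h, blockValue_eq_zero_iff hπ p hB] at hC'
      exact hπ.2 B hB C hC hC' (by
        rwa [← blockValue_eq_zero_iff hπ p hC, ← h, blockValue_eq_zero_iff hπ p hB])
  · rcases block_cases hπ hC with hC' | hC' | hC'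
    · exact absurd (by rw [hn, h]) (blockValue_inj_aux p hB' hC').2
    · exact neg_injective ((blockValue_inj_aux p hB' hC').1 (by rw [hn, hn', h]))
    · exact hπ.2 B hB C hC (by
        rwa [← blockValue_eq_zero_iff hπ p hB, h, blockValue_eq_zero_iff hπ p hC]) hC'
  · exact hπ.2 B hB C hC hB' (by
      rwa [← blockValue_eq_zero_iff hπ p hC, ← h, blockValue_eq_zero_iff hπ p hB])

lemma neg_part (hπ : IsBPartition π) {x : ℤ} (hx : x ∈ ground n) : π.part (-x) = -π.part x := by
  apply π.part_eq_of_mem (hπ.1 _ (π.part_mem.2 hx))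
  rw [Finset.mem_neg', neg_neg]
  exact π.mem_part hx

lemma blockValue_mem_Icc (p : (halfParts π ↪ Fin k) × (halfParts π → ℤˣ)) (B : Finset ℤ) :
    blockValue p B ∈ Finset.Icc (-(k : ℤ)) k := by
  have key : ∀ (s : ℤˣ) (a : Fin k), (s : ℤ) * ((a : ℕ) + 1) ∈ Finset.Icc (-(k : ℤ)) k := by
    intro s a
    rw [Finset.mem_Icc]
    rcases Int.units_eq_one_or s with rfl | rfl <;> simp <;> omega
  unfold blockValue
  split_ifs
  · exact key _ _
  · have := key (p.2 ⟨-B, ‹_›⟩) (p.1 ⟨-B, ‹_›⟩)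
    rw [Finset.mem_Icc] at this ⊢
    omega
  · simp

/-- The odd maps into `{-k, …, k}` whose fibres are the blocks of `π`. -/
noncomputable def fibreMaps (π : Finpartition (ground n)) (k : ℕ) : Finset (Fin n → ℤ) :=
  (Fintype.piFinset fun _ : Fin n => Finset.Icc (-(k : ℤ)) k).filter
    (fun f => ker n (oddExt f) = π)

/-- The map on `{1, …, n}` with the prescribed labels and signs. -/
noncomputable def labelMap (p : (halfParts π ↪ Fin k) × (halfParts π → ℤˣ)) (i : Fin n) : ℤ :=
  blockValue p (π.part ((i : ℤ) + 1))

lemma oddExt_labelMap (hπ : IsBPartition π) (p : (halfParts π ↪ Fin k) × (halfParts π → ℤˣ))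
    {x : ℤ} (hx : x ∈ ground n) : oddExt (labelMap p) x = blockValue p (π.part x) :=
  eq_oddExt (h := fun x => blockValue p (π.part x))
    (fun x hx => by rw [neg_part hπ hx, blockValue_neg]) hx

lemma labelMap_mem (hπ : IsBPartition π) (p : (halfParts π ↪ Fin k) × (halfParts π → ℤˣ)) :
    labelMap p ∈ fibreMaps π k := by
  refine Finset.mem_filter.2 ⟨Fintype.mem_piFinset.2 fun i => blockValue_mem_Icc p _, ?_⟩
  rw [ker_eq_iff]
  intro x hx y hy
  rw [oddExt_labelMap hπ p hx, oddExt_labelMap hπ p hy]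
  exact ⟨blockValue_inj hπ p (π.part_mem.2 hx) (π.part_mem.2 hy), fun h => by rw [h]⟩

lemma labelMap_injective (hπ : IsBPartition π) :
    Function.Injective (labelMap : (halfParts π ↪ Fin k) × (halfParts π → ℤˣ) → Fin n → ℤ) := by
  intro p q h
  have key : ∀ B : halfParts π, p.2 B = q.2 B ∧ (p.1 B : ℕ) = q.1 B := by
    rintro ⟨B, hB⟩
    obtain ⟨x, hx, -, e⟩ := exists_eq_part (Finset.mem_filter.1 hB).1
    have h1 := oddExt_labelMap hπ p hx
    rw [h, oddExt_labelMap hπ q hx, e, blockValue_of_mem p hB, blockValue_of_mem q hB] at h1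
    exact ⟨(unit_mul_inj h1).1.symm, (unit_mul_inj h1).2.symm⟩
  refine Prod.ext (DFunLike.ext _ _ fun B => Fin.ext (key B).2) (funext fun B => (key B).1)

lemma exists_labelMap_eq (hπ : IsBPartition π) {f : Fin n → ℤ} (hf : f ∈ fibreMaps π k) :
    ∃ p : (halfParts π ↪ Fin k) × (halfParts π → ℤˣ), labelMap p = f := by
  obtain ⟨hf1, hf2⟩ := Finset.mem_filter.1 hf
  rw [ker_eq_iff] at hf2
  rw [Fintype.mem_piFinset] at hf1
  have hbd : ∀ x ∈ ground n, -(k : ℤ) ≤ oddExt f x ∧ oddExt f x ≤ k := by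
    intro x hx
    obtain ⟨i, rfl | rfl⟩ := mem_ground_cases hx
    · have := hf1 i
      rw [Finset.mem_Icc] at this
      rw [oddExt_succ]; omega
    · have := hf1 i
      rw [Finset.mem_Icc] at this
      rw [oddExt_neg, oddExt_succ]; omega
  have hex : ∀ B : halfParts π, ∃ a : Fin k × ℤˣ, ∃ x ∈ ground n, π.part x = B ∧
      oddExt f x = (a.2 : ℤ) * ((a.1 : ℕ) + 1) := by
    rintro ⟨B, hB⟩
    obtain ⟨x, hx, -, e⟩ := exists_eq_part (Finset.mem_filter.1 hB).1
    have hne : oddExt f x ≠ 0 := by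
      intro h0
      have := (hf2.isZeroBlock_iff (oddExt_neg f) hx).2 h0
      have h2 := (Finset.mem_filter.1 hB).2
      rw [e] at this
      rw [← show B = -B from this] at h2
      exact lt_irrefl _ h2
    have hb := hbd x hx
    rcases lt_or_gt_of_ne hne with h | h
    · refine ⟨(⟨(oddExt f x).natAbs - 1, by omega⟩, -1), x, hx, e, ?_⟩
      simp only [Units.val_neg, Units.val_one]
      omega
    · refine ⟨(⟨(oddExt f x).natAbs - 1, by omega⟩, 1), x, hx, e, ?_⟩
      simp only [Units.val_one]
      omega
  choose a x hx hpart hval using hex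
  have hinj : Function.Injective (fun B => (a B).1) := by
    intro B C h
    have h' : (a B).1 = (a C).1 := h
    have hBC : oddExt f (x B) = oddExt f (x C) ∨ oddExt f (x B) = oddExt f (-(x C)) := by
      rw [oddExt_neg, hval, hval, h']
      rcases Int.units_eq_one_or (a B).2 with e | e <;>
        rcases Int.units_eq_one_or (a C).2 with e' | e' <;> simp [e, e']
    rcases hBC with h1 | h1
    · rw [hf2 _ (hx B) _ (hx C), hpart, hpart] at h1
      exact Subtype.ext h1
    · rw [hf2 _ (hx B) _ (neg_mem_ground (hx C)), neg_part hπ (hx C), hpart, hpart] at h1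
      exact absurd (h1 ▸ B.2) (neg_notMem_halfParts C.2)
  refine ⟨(⟨fun B => (a B).1, hinj⟩, fun B => (a B).2), ?_⟩
  set p : (halfParts π ↪ Fin k) × (halfParts π → ℤˣ) :=
    (⟨fun B => (a B).1, hinj⟩, fun B => (a B).2) with hp
  have key : ∀ y ∈ ground n, π.part y ∈ halfParts π →
      blockValue p (π.part y) = oddExt f y := by
    intro y hy h
    rw [blockValue_of_mem p h, hf2 y hy (x ⟨_, h⟩) (hx _) |>.2 (hpart ⟨_, h⟩).symm, hval]
    rfl
  funext i
  have hi := succ_mem_ground i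
  rw [← oddExt_succ f i, labelMap]
  rcases block_cases hπ (π.part_mem.2 hi) with h | h | h
  · exact key _ hi h
  · rw [← neg_part hπ hi] at h
    have := key _ (neg_mem_ground hi) h
    rw [neg_part hπ hi, blockValue_neg, oddExt_neg] at this
    exact neg_injective this
  · rw [(blockValue_eq_zero_iff hπ p (π.part_mem.2 hi)).2 h,
      (hf2.isZeroBlock_iff (oddExt_neg f) hi).1 h]

/-- Such a map amounts to distinct absolute values in {1, …, k} for the pairs {B, -B}, and a sign
for each pair. A zero-block must get the value 0, so it contributes no factor. -/
lemma card_fibreMaps (hπ : IsBPartition π) (k : ℕ) :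
    (fibreMaps π k).card = k.descFactorial (halfParts π).card * 2 ^ (halfParts π).card := by
  have h := Finset.card_nbij (s := Finset.univ) (t := fibreMaps π k)
    (labelMap : (halfParts π ↪ Fin k) × (halfParts π → ℤˣ) → Fin n → ℤ)
    (fun p _ => labelMap_mem hπ p) (labelMap_injective hπ).injOn
    (fun f hf => by
      obtain ⟨p, rfl⟩ := exists_labelMap_eq hπ hf
      exact ⟨p, Finset.mem_coe.2 (Finset.mem_univ _), rfl⟩)
  rw [← h, Finset.card_univ, Fintype.card_prod, Fintype.card_embedding_eq, Fintype.card_fun,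
    Fintype.card_units_int, Fintype.card_coe, Fintype.card_fin]

end fibre

open Classical in
lemma sum_card_fibreMaps (n k : ℕ) :
    ∑ π : Finpartition (ground n) with IsBPartition π, (fibreMaps π k).card = (2 * k + 1) ^ n := by
  have h := Finset.card_eq_sum_card_fiberwise
    (s := Fintype.piFinset fun _ : Fin n => Finset.Icc (-(k : ℤ)) k)
    (t := Finset.univ.filter (fun π : Finpartition (ground n) => IsBPartition π))
    (f := fun f => ker n (oddExt f))
    (fun f _ => by simpa using (isKer_ker n (oddExt f)).isBPartition (oddExt_neg f))
  rw [Fintype.card_piFinset_const, Int.card_Icc] at h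
  rw [show 2 * k + 1 = ((k : ℤ) + 1 - -(k : ℤ)).toNat by omega, h]
  exact Finset.sum_congr rfl fun π _ => congrArg Finset.card (by unfold fibreMaps; congr)

open Classical in
lemma sum_card_fibreMaps_of_no_zeroBlock (n k : ℕ) :
    ∑ π : Finpartition (ground n) with (IsBPartition π ∧ ∀ B ∈ π.parts, ¬ IsZeroBlock B),
      (fibreMaps π k).card = (2 * k) ^ n := by
  have hfib : ∀ f : Fin n → ℤ, (∀ B ∈ (ker n (oddExt f)).parts, ¬ IsZeroBlock B) ↔
      ∀ i, f i ≠ 0 := by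
    intro f
    have H := isKer_ker n (oddExt f)
    constructor
    · intro h i hi
      refine h _ (Finpartition.part_mem _ |>.2 (succ_mem_ground i)) ?_
      rw [H.isZeroBlock_iff (oddExt_neg f) (succ_mem_ground i), oddExt_succ, hi]
    · intro h B hB
      obtain ⟨x, hx, -, rfl⟩ := exists_eq_part hB
      rw [H.isZeroBlock_iff (oddExt_neg f) hx]
      obtain ⟨i, rfl | rfl⟩ := mem_ground_cases hx
      · rw [oddExt_succ]; exact h i
      · rw [oddExt_neg, oddExt_succ]; exact neg_ne_zero.2 (h i)
  have h := Finset.card_eq_sum_card_fiberwise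
    (s := Fintype.piFinset fun _ : Fin n => (Finset.Icc (-(k : ℤ)) k).erase 0)
    (t := Finset.univ.filter (fun π : Finpartition (ground n) =>
      IsBPartition π ∧ ∀ B ∈ π.parts, ¬ IsZeroBlock B))
    (f := fun f => ker n (oddExt f))
    (fun f hf => by
      simp only [Finset.coe_filter, Set.mem_ofPred_eq, Finset.mem_univ, true_and]
      refine ⟨(isKer_ker n (oddExt f)).isBPartition (oddExt_neg f), (hfib f).2 fun i => ?_⟩
      exact (Finset.mem_erase.1 (Fintype.mem_piFinset.1 (Finset.mem_coe.1 hf) i)).1)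
  rw [Fintype.card_piFinset_const, Finset.card_erase_of_mem (by simp), Int.card_Icc] at h
  rw [show 2 * k = ((k : ℤ) + 1 - -(k : ℤ)).toNat - 1 by omega, h]
  refine Finset.sum_congr rfl fun π hπ => congrArg Finset.card ?_
  rw [Finset.mem_filter] at hπ
  ext f
  simp only [fibreMaps, Finset.mem_filter, Fintype.mem_piFinset, Finset.mem_erase]
  constructor
  · rintro ⟨h1, rfl⟩
    exact ⟨fun i => ⟨(hfib f).1 hπ.2.2 i, h1 i⟩, rfl⟩
  · rintro ⟨h1, h2⟩
    exact ⟨fun i => (h1 i).2, h2⟩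

end TypeB

/-! ### Moments of the doubled Poisson variable -/

namespace TypeB

open Polynomial

/-- The weights of the Poisson distribution with mean `1 / 2`. -/
noncomputable def weight (k : ℕ) : ℝ := Real.exp (-(1 / 2)) * ((1 / 2) ^ k / k.factorial)

lemma weight_pos (k : ℕ) : 0 < weight k := by
  unfold weight; positivity

lemma two_mul_weight_succ (k : ℕ) : 2 * ((k : ℝ) + 1) * weight (k + 1) = weight k := by
  unfold weight
  rw [Nat.factorial_succ]
  push_cast
  field_simp
  ring_nf

lemma hasSum_weight : HasSum weight 1 := by
  have h := (NormedSpace.expSeries_div_hasSum_exp (1 / 2 : ℝ)).mul_left (Real.exp (-(1 / 2)))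
  rwa [← Real.exp_eq_exp_ℝ, ← Real.exp_add, neg_add_cancel, Real.exp_zero] at h

/-- The b-th factorial moment of the Poisson law with mean 1/2 is 2^(-b): the terms k < b vanish and
shifting by b recovers the weights. -/
lemma hasSum_weight_mul_descFactorial (b : ℕ) :
    HasSum (fun k => weight k * ((k.descFactorial b * 2 ^ b : ℕ) : ℝ)) 1 := by
  have h : HasSum (fun k => weight (k + b) * (((k + b).descFactorial b * 2 ^ b : ℕ) : ℝ)) 1 := by
    convert hasSum_weight using 2 with k
    have h1 := Nat.factorial_mul_descFactorial (Nat.le_add_left b k)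
    rw [Nat.add_sub_cancel] at h1
    have h2 : ((k + b).factorial : ℝ) = k.factorial * (k + b).descFactorial b := by
      exact_mod_cast h1.symm
    have h3 : ((k + b).factorial : ℝ) ≠ 0 := by positivity
    have h4 : ((k + b).descFactorial b : ℝ) ≠ 0 := fun h0 => h3 (by rw [h2, h0, mul_zero])
    unfold weight
    rw [h2]
    push_cast
    rw [pow_add, one_div_pow 2 b]
    field_simp
  rw [hasSum_nat_add_iff (f := fun k => weight k * ((k.descFactorial b * 2 ^ b : ℕ) : ℝ))] at h
  rwa [Finset.sum_eq_zero, add_zero] at h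
  intro k hk
  rw [Nat.descFactorial_of_lt (Finset.mem_range.1 hk)]
  simp

lemma summable_weight_mul_eval (p : ℝ[X]) :
    Summable (fun k : ℕ => weight k * p.eval (2 * (k : ℝ))) := by
  induction p using Polynomial.induction_on' with
  | add p q hp hq => simpa [mul_add] using hp.add hq
  | monomial n a =>
    simp only [eval_monomial]
    have h : Summable (fun k : ℕ => weight k * (2 * (k : ℝ)) ^ n) := by
      -- Since (2k)^n ≤ n!·e^(2k), an exponential series at e²/2 dominates.
      refine Summable.of_nonneg_of_le (fun k => by have := weight_pos k; positivity) (fun k => ?_)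
        ((Real.summable_pow_div_factorial (1 / 2 * Real.exp 2)).mul_left
          (Real.exp (-(1 / 2)) * n.factorial))
      have h1 := Real.pow_div_factorial_le_exp (2 * (k : ℝ)) (by positivity) n
      rw [div_le_iff₀ (by positivity)] at h1
      calc weight k * (2 * (k : ℝ)) ^ n
          ≤ weight k * (Real.exp (2 * k) * n.factorial) :=
            mul_le_mul_of_nonneg_left h1 (weight_pos k).le
        _ = _ := by
          rw [mul_comm (2 : ℝ), Real.exp_nat_mul, weight, mul_pow]
          ring
    refine (h.mul_left a).congr fun k => ?_
    ring

/-- The expectation of `p(X)`, where `X / 2` has the Poisson distribution with mean `1 / 2`. -/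
noncomputable def expect : ℝ[X] →ₗ[ℝ] ℝ where
  toFun p := ∑' k : ℕ, weight k * p.eval (2 * (k : ℝ))
  map_add' p q := by
    rw [← (summable_weight_mul_eval p).tsum_add (summable_weight_mul_eval q)]
    simp [mul_add]
  map_smul' a p := by
    rw [RingHom.id_apply, smul_eq_mul, ← tsum_mul_left]
    congr with k
    simp only [eval_smul, smul_eq_mul]
    ring

lemma expect_apply (p : ℝ[X]) : expect p = ∑' k : ℕ, weight k * p.eval (2 * (k : ℝ)) := rfl

lemma expect_mono {p q : ℝ[X]} (h : ∀ k : ℕ, p.eval (2 * (k : ℝ)) ≤ q.eval (2 * (k : ℝ))) :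
    expect p ≤ expect q :=
  (summable_weight_mul_eval p).tsum_le_tsum
    (fun k => mul_le_mul_of_nonneg_left (h k) (weight_pos k).le) (summable_weight_mul_eval q)

/-- Strict positivity is asked at k = 1 because X^n vanishes at k = 0 for n > 0. -/
lemma expect_pos {p : ℝ[X]} (h : ∀ k : ℕ, 0 ≤ p.eval (2 * (k : ℝ))) (h1 : 0 < p.eval 2) :
    0 < expect p :=
  (summable_weight_mul_eval p).tsum_pos (fun k => mul_nonneg (weight_pos k).le (h k)) 1
    (mul_pos (weight_pos 1) (by simpa using h1))

/-- The Stein–Chen identity: the term k = 0 vanishes, and `two_mul_weight_succ` absorbs the factor X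
after an index shift. -/
lemma expect_X_mul (p : ℝ[X]) : expect (X * p) = expect (p.comp (X + C 2)) := by
  rw [expect_apply, expect_apply, (summable_weight_mul_eval (X * p)).tsum_eq_zero_add]
  simp only [eval_mul, eval_X, Nat.cast_zero, mul_zero, zero_mul, zero_add]
  refine tsum_congr fun k => ?_
  rw [← two_mul_weight_succ k, eval_comp]
  simp only [eval_add, eval_X, eval_C]
  push_cast
  rw [show 2 * ((k : ℝ) + 1) = 2 * k + 2 by ring]
  ring

lemma card_eq_tsum {n : ℕ} (S : Finset (Finpartition (ground n)))
    (hS : ∀ π ∈ S, IsBPartition π) (f : ℕ → ℕ)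
    (hf : ∀ k, ∑ π ∈ S, (fibreMaps π k).card = f k) :
    (S.card : ℝ) = ∑' k : ℕ, weight k * f k := by
  have h : HasSum (fun k => ∑ π ∈ S, weight k * ((fibreMaps π k).card : ℝ)) (∑ π ∈ S, 1) := by
    refine hasSum_sum fun π hπ => ?_
    simp only [card_fibreMaps (hS π hπ)]
    exact hasSum_weight_mul_descFactorial _
  rw [Finset.sum_const, nsmul_eq_mul, mul_one] at h
  rw [← h.tsum_eq]
  refine tsum_congr fun k => ?_
  rw [← Finset.mul_sum, ← Nat.cast_sum, hf]

lemma M_eq_expect (n : ℕ) : (M n : ℝ) = expect ((X + C 1) ^ n) := by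
  classical
  rw [M, Nat.card_eq_fintype_card, Fintype.card_subtype,
    card_eq_tsum _ (fun π hπ => (Finset.mem_filter.1 hπ).2) (fun k => (2 * k + 1) ^ n)
      (fun k => by convert sum_card_fibreMaps n k), expect_apply]
  simp

lemma N_eq_expect (n : ℕ) : (N n : ℝ) = expect ((X + C 0) ^ n) := by
  classical
  rw [N, Nat.card_eq_fintype_card, Fintype.card_subtype,
    card_eq_tsum _ (fun π hπ => (Finset.mem_filter.1 hπ).2.1) (fun k => (2 * k) ^ n)
      (fun k => by convert sum_card_fibreMaps_of_no_zeroBlock n k), expect_apply]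
  simp

/-- A convex power lies above its tangent at b. In the induction, a times the old tangent exceeds
the new one by (m+1) b^m (a-b)². -/
lemma pow_tangent {a b : ℝ} (ha : 0 ≤ a) (hb : 0 ≤ b) (m : ℕ) :
    b ^ (m + 1) + (m + 1) * b ^ m * (a - b) ≤ a ^ (m + 1) := by
  induction m with
  | zero => simp
  | succ m ih =>
    have h := mul_le_mul_of_nonneg_left ih ha
    have h2 : 0 ≤ ((m : ℝ) + 1) * b ^ m * (a - b) ^ 2 := by positivity
    push_cast
    calc _ = a * (b ^ (m + 1) + (m + 1) * b ^ m * (a - b)) - (m + 1) * b ^ m * (a - b) ^ 2 := by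
            ring
      _ ≤ a * (b ^ (m + 1) + (m + 1) * b ^ m * (a - b)) := by linarith
      _ ≤ a * a ^ (m + 1) := h
      _ = _ := by ring

/-- Jensen's inequality for the convex function `u ↦ (1 + σ * u) ^ (m + 1)` of `u = 1 / Y` under
the weight `Y ^ (m + 1) * g`. -/
lemma expect_jensen (Y g : ℝ[X]) (σ v : ℝ) (m : ℕ)
    (hY : ∀ k : ℕ, 0 ≤ Y.eval (2 * (k : ℝ))) (hg : ∀ k : ℕ, 0 ≤ g.eval (2 * (k : ℝ)))
    (h : ∀ k : ℕ, g.eval (2 * (k : ℝ)) = 0 ∨ 0 ≤ Y.eval (2 * (k : ℝ)) + σ)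
    (hv : expect (Y ^ m * g) = v * expect (Y ^ (m + 1) * g)) (h1 : 0 ≤ 1 + σ * v) :
    (1 + σ * v) ^ (m + 1) * expect (Y ^ (m + 1) * g) ≤ expect ((Y + C σ) ^ (m + 1) * g) := by
  -- The tangent inequality at a = Y + σ, b = (1 + σv)Y, times g. By `hv` the linear term has
  -- expectation 0.
  have key := expect_mono
    (p := (1 + σ * v) ^ (m + 1) • (Y ^ (m + 1) * g) + ((m + 1) * (1 + σ * v) ^ m * σ) •
      (Y ^ m * g - v • (Y ^ (m + 1) * g))) (q := (Y + C σ) ^ (m + 1) * g) (fun k => by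
    simp only [eval_add, eval_smul, eval_mul, eval_pow, eval_sub, smul_eq_mul, eval_C]
    rcases h k with h0 | h0
    · simp [h0]
    · have ht := mul_le_mul_of_nonneg_right
        (pow_tangent h0 (mul_nonneg h1 (hY k)) m) (hg k)
      refine le_trans (le_of_eq ?_) ht
      rw [mul_pow, mul_pow]
      ring)
  rwa [map_add, map_smul, map_smul, map_sub, map_smul, smul_eq_mul, smul_eq_mul, smul_eq_mul, hv,
    sub_self, mul_zero, add_zero] at key

/-- The moments of `X + c`. -/
noncomputable def moment (c : ℝ) (n : ℕ) : ℝ := expect ((X + C c) ^ n)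

/-- The ratio of consecutive moments of `X + c`. -/
noncomputable def ratio (c : ℝ) (n : ℕ) : ℝ := moment c (n + 1) / moment c n

/-! ### Bounds for ratios of consecutive moments -/

section ratio

variable {c : ℝ}

lemma eval_nonneg (hc : 0 ≤ c) (k : ℕ) : 0 ≤ (X + C c : ℝ[X]).eval (2 * (k : ℝ)) := by
  simp only [eval_add, eval_X, eval_C]; positivity

lemma moment_pos (hc : 0 ≤ c) (n : ℕ) : 0 < moment c n :=
  expect_pos (fun k => by rw [eval_pow]; exact pow_nonneg (eval_nonneg hc k) n)
    (by simp only [eval_pow, eval_add, eval_X, eval_C]; positivity)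

lemma ratio_pos (hc : 0 ≤ c) (n : ℕ) : 0 < ratio c n :=
  div_pos (moment_pos hc _) (moment_pos hc _)

lemma moment_succ (hc : 0 ≤ c) (n : ℕ) : moment c (n + 1) = ratio c n * moment c n :=
  (div_mul_cancel₀ _ (moment_pos hc n).ne').symm

lemma moment_eq (hc : 0 ≤ c) (n : ℕ) : moment c n = 1 / ratio c n * moment c (n + 1) := by
  rw [moment_succ hc, ← mul_assoc, one_div_mul_cancel (ratio_pos hc n).ne', one_mul]

/-- Log-convexity of moments, from E[(X+c)^n (X+c-v)²] ≥ 0 with v = `ratio c n`. -/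
lemma ratio_le_succ (hc : 0 ≤ c) (n : ℕ) : ratio c n ≤ ratio c (n + 1) := by
  set v := ratio c n with hv
  have h := expect_mono (p := 0) (q := (X + C c) ^ (n + 2) - (2 * v) • (X + C c) ^ (n + 1) +
    v ^ 2 • (X + C c) ^ n) (fun k => by
      have h0 := eval_nonneg hc k
      simp only [eval_zero, eval_add, eval_sub, eval_smul, eval_pow, smul_eq_mul, eval_X, eval_C]
        at h0 ⊢
      have : 0 ≤ (2 * (k : ℝ) + c) ^ n * (2 * k + c - v) ^ 2 := by positivity
      refine this.trans (le_of_eq (by ring)))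
  rw [map_zero, map_add, map_sub, map_smul, map_smul, smul_eq_mul, smul_eq_mul] at h
  change 0 ≤ moment c (n + 2) - 2 * v * moment c (n + 1) + v ^ 2 * moment c n at h
  rw [moment_succ hc (n + 1), moment_succ hc n, ← hv] at h
  have hp := mul_pos (ratio_pos hc n) (moment_pos hc n)
  rw [← hv] at hp
  by_contra! hlt
  nlinarith [mul_pos (sub_pos.2 hlt) hp]

lemma expect_X_mul_pow (c : ℝ) (n : ℕ) :
    expect ((X + C c) ^ n * X) = moment c (n + 1) - c * moment c n := by
  have h : (X + C c) ^ n * X = (X + C c) ^ (n + 1) - c • (X + C c) ^ n := by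
    rw [smul_eq_C_mul]; ring
  rw [h, map_sub, map_smul, smul_eq_mul]
  rfl

/-- Jensen with shift 2: E(X+c+2)^(m+1) equals E[X (X+c)^(m+1)] by `expect_X_mul`. -/
lemma ratio_lower (hc : 0 ≤ c) (m : ℕ) :
    (1 + 2 / ratio c m) ^ (m + 1) ≤ ratio c (m + 1) - c := by
  have hr := ratio_pos hc m
  have h := expect_jensen (X + C c) 1 2 (1 / ratio c m) m (eval_nonneg hc) (by simp)
    (fun k => Or.inr (add_nonneg (eval_nonneg hc k) zero_le_two))
    (by simpa [moment] using moment_eq hc m) (by positivity)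
  have h2 : expect ((X + C c + C 2) ^ (m + 1)) = moment c (m + 2) - c * moment c (m + 1) := by
    rw [← expect_X_mul_pow, mul_comm _ X, expect_X_mul]
    simp [add_right_comm]
  rw [mul_one, mul_one, h2, moment_succ hc (m + 1), ← sub_mul] at h
  have := le_of_mul_le_mul_right h (moment_pos hc (m + 1))
  rwa [mul_one_div] at this

/-- Jensen with shift -2 and extra weight X, where E[X (X+c-2)^(m+1)] = E(X+c)^(m+1). Monotonicity
of the ratios then replaces v by 1/q and q' by q. -/
lemma ratio_upper (hc : 0 ≤ c) (hc1 : c ≤ 1) (m : ℕ) (h2 : 2 < ratio c m) :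
    (1 - 2 / ratio c m) ^ (m + 1) * (ratio c m - c) ≤ 1 := by
  have hmono := ratio_le_succ hc m
  have hm := moment_pos hc m
  have hm1 := moment_pos hc (m + 1)
  set q := ratio c m with hq
  set q' := ratio c (m + 1) with hq'
  have hqc : 0 < q - c := by linarith
  have hqc' : 0 < q' - c := by linarith
  set v := 1 / q * ((q - c) / (q' - c)) with hv
  have hvle : v ≤ 1 / q := by
    have : (q - c) / (q' - c) ≤ 1 := by rw [div_le_one hqc']; linarith
    calc v ≤ 1 / q * 1 := mul_le_mul_of_nonneg_left this (by positivity)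
      _ = 1 / q := mul_one _
  have hq2 : 0 ≤ 1 - 2 / q := by
    rw [sub_nonneg, div_le_one (by linarith)]; exact h2.le
  have hle : 1 - 2 / q ≤ 1 + (-2) * v := by
    have : 2 / q = 2 * (1 / q) := by ring
    rw [this]; linarith
  have h := expect_jensen (X + C c) X (-2) v m (eval_nonneg hc) (by simp)
    (fun k => by
      -- X + c - 2 can be negative only at k = 0, where the weight X vanishes.
      rcases Nat.eq_zero_or_pos k with rfl | hk
      · left; simp
      · right
        have : (1 : ℝ) ≤ k := by exact_mod_cast hk
        simp only [eval_add, eval_X, eval_C]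
        linarith)
    (by
      rw [expect_X_mul_pow, expect_X_mul_pow, moment_succ hc (m + 1), ← hq', ← sub_mul,
        moment_succ hc m, ← hq, ← sub_mul, hv]
      have : q ≠ 0 := by linarith
      field_simp)
    (hq2.trans hle)
  have h3 : expect ((X + C c + C (-2)) ^ (m + 1) * X) = moment c (m + 1) := by
    rw [mul_comm _ X, expect_X_mul]
    congr 1
    simp only [pow_comp, add_comp, X_comp, C_comp]
    rw [C_neg]
    ring
  rw [h3, expect_X_mul_pow, moment_succ hc (m + 1), ← hq', ← sub_mul, ← mul_assoc] at h
  have h4 : (1 + (-2) * v) ^ (m + 1) * (q' - c) ≤ 1 := by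
    refine le_of_mul_le_mul_right ?_ hm1
    rwa [one_mul]
  refine le_trans ?_ h4
  exact mul_le_mul (pow_le_pow_left₀ hq2 hle _) (by linarith) hqc.le
    (pow_nonneg (hq2.trans hle) _)

end ratio

lemma moment_one_lower (m : ℕ) :
    (1 + 1 / ratio 0 m) ^ (m + 1) * moment 0 (m + 1) ≤ moment 1 (m + 1) := by
  have hr := ratio_pos le_rfl m
  have h := expect_jensen (X + C 0) 1 1 (1 / ratio 0 m) m (eval_nonneg le_rfl) (by simp)
    (fun k => Or.inr (add_nonneg (eval_nonneg le_rfl k) zero_le_one))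
    (by simpa [moment] using moment_eq le_rfl m) (by positivity)
  rw [one_mul, mul_one, mul_one, C_0, add_zero] at h
  simpa [moment] using h

lemma moment_one_upper (m : ℕ) (h1 : 1 < ratio 1 m) :
    (1 - 1 / ratio 1 m) ^ (m + 1) * moment 1 (m + 1) ≤ moment 0 (m + 1) := by
  have hle : 1 / ratio 1 m ≤ 1 := by rw [div_le_one (by linarith)]; exact h1.le
  have h := expect_jensen (X + C 1) 1 (-1) (1 / ratio 1 m) m (eval_nonneg zero_le_one) (by simp)
    (fun k => Or.inr (by simp))
    (by simpa [moment] using moment_eq zero_le_one m) (by linarith)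
  rw [neg_one_mul, ← sub_eq_add_neg, mul_one, mul_one, add_assoc, ← C_add, add_neg_cancel] at h
  exact h

end TypeB

/-! ### Asymptotics -/

namespace TypeB

open Filter Topology Real

lemma tendsto_log_log_comp_add_sub (y : ℝ) :
    Tendsto (fun x : ℝ => log (log (x + y)) - log (log x)) atTop (𝓝 0) := by
  have h1 : Tendsto (fun x : ℝ => 1 + (log (x + y) - log x) / log x) atTop (𝓝 1) := by
    simpa using ((tendsto_log_comp_add_sub_log y).div_atTop tendsto_log_atTop).const_add 1
  have h2 := h1.log one_ne_zero
  rw [log_one] at h2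
  refine h2.congr' ?_
  filter_upwards [tendsto_log_atTop.eventually_gt_atTop 0,
    (tendsto_log_atTop.comp (tendsto_atTop_add_const_right _ y tendsto_id)).eventually_gt_atTop 0]
    with x h h'
  have h' : 0 < log (x + y) := h'
  rw [← log_div h'.ne' h.ne']
  congr 1
  field_simp
  ring

lemma tendsto_log_div_add (y : ℝ) : Tendsto (fun x : ℝ => log x / (x + y)) atTop (𝓝 0) := by
  have h1 := isLittleO_log_id_atTop.tendsto_div_nhds_zero
  have h2 : Tendsto (fun x : ℝ => 1 + y / x) atTop (𝓝 1) := by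
    simpa using (tendsto_const_nhds (x := y)).div_atTop tendsto_id |>.const_add 1
  have h3 := h1.div h2 one_ne_zero
  rw [zero_div] at h3
  refine h3.congr' ?_
  filter_upwards [eventually_gt_atTop 0, eventually_gt_atTop (-y)] with x hx hy
  have : x + y ≠ 0 := by linarith
  simp only [Pi.div_apply, id]
  field_simp

section asymptotics

variable {q : ℕ → ℝ}

/-- If `q log q ≈ 2 n` then `q ~ 2 n / log n`. -/
lemma tendsto_log_of_bounds (hq : Tendsto q atTop atTop)
    (lower : ∀ᶠ m : ℕ in atTop, 2 * ((m : ℝ) + 1) ≤ (q m + 4) * log (q m))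
    (upper : ∀ᶠ m : ℕ in atTop, (q m - 2) * log (q m - 1) ≤ 2 * ((m : ℝ) + 1)) :
    Tendsto (fun m : ℕ => log (q m) + log (log ((m : ℝ) + 1)) - log (2 * ((m : ℝ) + 1)))
      atTop (𝓝 0) := by
  have hlq := tendsto_log_atTop.comp hq
  have hn : Tendsto (fun m : ℕ => (m : ℝ) + 1) atTop atTop :=
    tendsto_atTop_add_const_right _ 1 tendsto_natCast_atTop_atTop
  -- Logarithms of both bounds: the shifts of q by constants cost o(1).
  have h1 : Tendsto (fun m : ℕ => log (2 * ((m : ℝ) + 1)) - log (q m) - log (log (q m)))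
      atTop (𝓝 0) := by
    have hL := ((tendsto_log_comp_add_sub_log (-2)).comp hq).add
      ((tendsto_log_log_comp_add_sub (-1)).comp hq)
    rw [add_zero] at hL
    refine tendsto_of_tendsto_of_tendsto_of_le_of_le' hL
      ((tendsto_log_comp_add_sub_log 4).comp hq) ?_ ?_
    · filter_upwards [upper, hq.eventually_gt_atTop 3] with m hu h3
      have hl : 0 < log (q m - 1) := log_pos (by linarith)
      have h2 : 0 < q m - 2 := by linarith
      have := log_le_log (by positivity) hu
      rw [log_mul h2.ne' hl.ne'] at this
      simp only [Function.comp, ← sub_eq_add_neg]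
      linarith
    · filter_upwards [lower, hq.eventually_gt_atTop 3] with m hu h3
      have hl : 0 < log (q m) := log_pos (by linarith)
      have h2 : 0 < q m + 4 := by linarith
      have := log_le_log (by positivity) hu
      rw [log_mul h2.ne' hl.ne'] at this
      simp only [Function.comp]
      linarith
  -- This allows log log q to be replaced by log log (m+1).
  have h2 : Tendsto (fun m : ℕ => log ((m : ℝ) + 1) / log (q m)) atTop (𝓝 1) := by
    have ha := (h1.sub_const (log 2)).div_atTop hlq
    have hb := (isLittleO_log_id_atTop.tendsto_div_nhds_zero.comp hlq)
    have hc := (ha.add hb).const_add 1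
    rw [add_zero, add_zero] at hc
    refine hc.congr' ?_
    filter_upwards [hlq.eventually_gt_atTop 0] with m hm
    have hm : 0 < log (q m) := hm
    have hp : (m : ℝ) + 1 ≠ 0 := by positivity
    simp only [Function.comp, id]
    rw [log_mul two_ne_zero hp]
    field_simp
    ring
  have h3 := h2.log one_ne_zero
  rw [log_one] at h3
  have h4 := h3.sub h1
  rw [sub_zero] at h4
  refine h4.congr' ?_
  filter_upwards [hlq.eventually_gt_atTop 0, (tendsto_log_atTop.comp hn).eventually_gt_atTop 0]
    with m hm hm'
  simp only [Function.comp] at hm hm'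
  rw [log_div hm'.ne' hm.ne']
  ring

lemma lower_exponent (hq : Tendsto q atTop atTop)
    (upper : ∀ᶠ m : ℕ in atTop, (q m - 2) * log (q m - 1) ≤ 2 * ((m : ℝ) + 1)) :
    ∃ e : ℕ → ℝ, Tendsto e atTop (𝓝 0) ∧
      ∀ᶠ m : ℕ in atTop, log (q m) / 2 + e m ≤ ((m : ℝ) + 1) / (q m + 1) := by
  -- The exact remainder of (x-2) log(x-1) / (2(x+1)) after subtracting (log x)/2, using x-2 = (x+1)
  -- - 3.
  have h : Tendsto (fun x : ℝ => ((log (x + -1) - log x) - 3 * ((log (x + -1) - log x) / (x + 1))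
      - 3 * (log x / (x + 1))) / 2) atTop (𝓝 0) := by
    have h1 := tendsto_log_comp_add_sub_log (-1)
    have h2 := h1.div_atTop (tendsto_atTop_add_const_right atTop (1 : ℝ) tendsto_id)
    have h3 := ((h1.sub (h2.const_mul 3)).sub ((tendsto_log_div_add 1).const_mul 3)).div_const 2
    simpa using h3
  refine ⟨_, h.comp hq, ?_⟩
  filter_upwards [upper, hq.eventually_gt_atTop 3] with m hu h3
  have hp : 0 < q m + 1 := by linarith
  rw [le_div_iff₀ hp]
  refine le_trans (le_of_eq ?_) (by linarith : (q m - 2) * log (q m - 1) / 2 ≤ (m : ℝ) + 1)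
  simp only [Function.comp, ← sub_eq_add_neg]
  field_simp
  ring

lemma upper_exponent (hq : Tendsto q atTop atTop)
    (lower : ∀ᶠ m : ℕ in atTop, 2 * ((m : ℝ) + 1) ≤ (q m + 4) * log (q m)) :
    ∃ e : ℕ → ℝ, Tendsto e atTop (𝓝 0) ∧
      ∀ᶠ m : ℕ in atTop, ((m : ℝ) + 1) / (q m - 1) ≤ log (q m) / 2 + e m := by
  -- The 5 comes from x+4 = (x-1) + 5.
  have h : Tendsto (fun x : ℝ => 5 / 2 * (log x / (x + -1))) atTop (𝓝 0) := by
    simpa using (tendsto_log_div_add (-1)).const_mul (5 / 2)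
  refine ⟨_, h.comp hq, ?_⟩
  filter_upwards [lower, hq.eventually_gt_atTop 3] with m hu h3
  have hp : 0 < q m - 1 := by linarith
  rw [div_le_iff₀ hp]
  refine le_trans (by linarith : (m : ℝ) + 1 ≤ (q m + 4) * log (q m) / 2) (le_of_eq ?_)
  simp only [Function.comp, ← sub_eq_add_neg]
  field_simp
  ring

end asymptotics

section ratio

variable {c : ℝ}

lemma ratio_lower_log (hc : 0 ≤ c) (m : ℕ) :
    2 * ((m : ℝ) + 1) ≤ (ratio c (m + 1) + 2) * log (ratio c (m + 1)) := by
  have hmono := ratio_le_succ hc m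
  have h0 := ratio_pos hc m
  have hq := ratio_pos hc (m + 1)
  have h := ratio_lower hc m
  set q := ratio c (m + 1)
  have h1 : (1 + 2 / q) ^ (m + 1) ≤ q := by
    refine le_trans (pow_le_pow_left₀ (by positivity) ?_ _) (h.trans (by linarith))
    gcongr
  have h2 := log_le_log (by positivity) h1
  rw [log_pow] at h2
  -- The bound log t ≥ 1 - 1/t gives log(1 + 2/q) ≥ 2/(q+2).
  have h3 := one_sub_inv_le_log_of_pos (x := 1 + 2 / q) (by positivity)
  have h4 : 1 - (1 + 2 / q)⁻¹ = 2 / (q + 2) := by field_simp; ring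
  rw [h4] at h3
  have h5 : ((m : ℝ) + 1) * (2 / (q + 2)) ≤ log q := by
    refine le_trans (mul_le_mul_of_nonneg_left h3 (by positivity)) ?_
    exact_mod_cast h2
  rw [← mul_div_assoc, div_le_iff₀ (by positivity)] at h5
  linarith

lemma ratio_upper_log (hc : 0 ≤ c) (hc1 : c ≤ 1) (m : ℕ) (h2 : 2 < ratio c m) :
    (ratio c m - 2) * log (ratio c m - 1) ≤ 2 * ((m : ℝ) + 1) := by
  have h := ratio_upper hc hc1 m h2
  set q := ratio c m
  have hx : 0 < 1 - 2 / q := by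
    rw [sub_pos, div_lt_one (by linarith)]; exact h2
  have h1 : (1 - 2 / q) ^ (m + 1) * (q - 1) ≤ 1 := by
    refine le_trans (mul_le_mul_of_nonneg_left ?_ (by positivity)) h
    linarith
  have h3 := log_le_log (mul_pos (by positivity) (by linarith)) h1
  rw [log_one, log_mul (by positivity) (by linarith), log_pow] at h3
  have h4 := one_sub_inv_le_log_of_pos hx
  have hq2 : q - 2 ≠ 0 := by linarith
  have hq0 : q ≠ 0 := by linarith
  have h5 : 1 - (1 - 2 / q)⁻¹ = -(2 / (q - 2)) := by
    rw [one_sub_div hq0, inv_div]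
    field_simp
    ring
  rw [h5] at h4
  have h6 := mul_le_mul_of_nonneg_left h4 (by positivity : 0 ≤ (m : ℝ) + 1)
  push_cast at h3
  have h7 : log (q - 1) ≤ ((m : ℝ) + 1) * (2 / (q - 2)) := by linarith
  rw [← mul_div_assoc, le_div_iff₀ (by linarith)] at h7
  linarith

lemma tendsto_ratio (hc : 0 ≤ c) : Tendsto (ratio c) atTop atTop := by
  rw [← tendsto_add_atTop_iff_nat 1, tendsto_atTop]
  intro b
  filter_upwards [tendsto_natCast_atTop_atTop.eventually_ge_atTop ((|b| + 2) * |b|)] with m hm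
  have h := ratio_lower_log hc m
  have hq := ratio_pos hc (m + 1)
  by_contra! hlt
  have h1 : ratio c (m + 1) ≤ |b| := hlt.le.trans (le_abs_self b)
  have h2 : log (ratio c (m + 1)) ≤ |b| := (log_le_self hq.le).trans h1
  have h3 : (ratio c (m + 1) + 2) * log (ratio c (m + 1)) ≤ (|b| + 2) * |b| :=
    (mul_le_mul_of_nonneg_left h2 (by linarith)).trans
      (mul_le_mul_of_nonneg_right (by linarith) (abs_nonneg b))
  have : (0 : ℝ) ≤ m := by positivity
  linarith

/-- Moving the index from m+1 to m costs 2, which is at most 2 log q once log q ≥ 1; hence 4 in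
place of 2. -/
lemma ratio_lower_eventually (hc : 0 ≤ c) :
    ∀ᶠ m : ℕ in atTop, 2 * ((m : ℝ) + 1) ≤ (ratio c m + 4) * log (ratio c m) := by
  filter_upwards [eventually_ge_atTop 1,
    (tendsto_log_atTop.comp (tendsto_ratio hc)).eventually_ge_atTop 1] with m hm hl
  obtain ⟨m, rfl⟩ := Nat.exists_eq_add_of_le' hm
  have hl : 1 ≤ log (ratio c (m + 1)) := hl
  have := ratio_lower_log hc m
  push_cast
  linarith

lemma ratio_upper_eventually (hc : 0 ≤ c) (hc1 : c ≤ 1) :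
    ∀ᶠ m : ℕ in atTop, (ratio c m - 2) * log (ratio c m - 1) ≤ 2 * ((m : ℝ) + 1) := by
  filter_upwards [(tendsto_ratio hc).eventually_gt_atTop 2] with m hm
  exact ratio_upper_log hc hc1 m hm

end ratio

lemma log_quotient_lower (m : ℕ) :
    ((m : ℝ) + 1) / (ratio 0 m + 1) ≤ log (moment 1 (m + 1)) - log (moment 0 (m + 1)) := by
  have hr := ratio_pos le_rfl m
  have hN := moment_pos le_rfl (m + 1)
  have h := log_le_log (by positivity) (moment_one_lower m)
  rw [log_mul (by positivity) hN.ne', log_pow] at h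
  have h3 := one_sub_inv_le_log_of_pos (x := 1 + 1 / ratio 0 m) (by positivity)
  have h4 : 1 - (1 + 1 / ratio 0 m)⁻¹ = 1 / (ratio 0 m + 1) := by field_simp; ring
  rw [h4] at h3
  have h6 := mul_le_mul_of_nonneg_left h3 (by positivity : 0 ≤ (m : ℝ) + 1)
  push_cast at h
  rw [mul_one_div] at h6
  linarith

lemma log_quotient_upper (m : ℕ) (h1 : 1 < ratio 1 m) :
    log (moment 1 (m + 1)) - log (moment 0 (m + 1)) ≤ ((m : ℝ) + 1) / (ratio 1 m - 1) := by
  have hM := moment_pos zero_le_one (m + 1)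
  have hx : 0 < 1 - 1 / ratio 1 m := by
    rw [sub_pos, div_lt_one (by linarith)]; exact h1
  have h := log_le_log (by positivity) (moment_one_upper m h1)
  rw [log_mul (by positivity) hM.ne', log_pow] at h
  have h3 := one_sub_inv_le_log_of_pos hx
  have hq2 : ratio 1 m - 1 ≠ 0 := by linarith
  have hq0 : ratio 1 m ≠ 0 := by linarith
  have h4 : 1 - (1 - 1 / ratio 1 m)⁻¹ = -(1 / (ratio 1 m - 1)) := by
    rw [one_sub_div hq0, inv_div]
    field_simp
    ring
  rw [h4] at h3
  have h6 := mul_le_mul_of_nonneg_left h3 (by positivity : 0 ≤ (m : ℝ) + 1)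
  push_cast at h
  rw [mul_neg, mul_one_div] at h6
  linarith

/-- The lower bound uses the ratios for c = 0 and the upper bound those for c = 1. Both have the
same asymptotics, so they need not be compared with each other. -/
lemma tendsto_log_quotient :
    Tendsto (fun m : ℕ => log (moment 1 (m + 1)) - log (moment 0 (m + 1)) +
      (log (log ((m : ℝ) + 1)) - log (2 * ((m : ℝ) + 1))) / 2) atTop (𝓝 0) := by
  have hr := tendsto_ratio (le_refl (0 : ℝ))
  have ht := tendsto_ratio (zero_le_one (α := ℝ))
  have ur := ratio_upper_eventually (le_refl (0 : ℝ)) zero_le_one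
  have lt := ratio_lower_eventually (zero_le_one (α := ℝ))
  have Lr := tendsto_log_of_bounds hr (ratio_lower_eventually le_rfl) ur
  have Lt := tendsto_log_of_bounds ht lt (ratio_upper_eventually zero_le_one le_rfl)
  obtain ⟨e, he, hle⟩ := lower_exponent hr ur
  obtain ⟨e', he', hle'⟩ := upper_exponent ht lt
  have h1 := (Lr.div_const 2).add he
  have h2 := (Lt.div_const 2).add he'
  rw [zero_div, add_zero] at h1 h2
  refine tendsto_of_tendsto_of_tendsto_of_le_of_le' h1 h2 ?_ ?_
  · filter_upwards [hle] with m hm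
    have := log_quotient_lower m
    linarith
  · filter_upwards [hle', ht.eventually_gt_atTop 1] with m hm h1
    have := log_quotient_upper m h1
    linarith

end TypeB

theorem mainTheorem7 :
    Asymptotics.IsEquivalent Filter.atTop
      (fun n : ℕ => (TypeB.N n : ℝ) / (TypeB.M n : ℝ))
      (fun n : ℕ => Real.sqrt (Real.log (n : ℝ) / (2 * (n : ℝ)))) := by
  apply Asymptotics.isEquivalent_of_tendsto_one
  rw [← Filter.tendsto_add_atTop_iff_nat 1]
  have h := TypeB.tendsto_log_quotient.neg.rexp
  rw [neg_zero, Real.exp_zero] at h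
  refine h.congr' ?_
  filter_upwards [Filter.eventually_ge_atTop 1] with m hm
  have hN : 0 < TypeB.moment 0 (m + 1) := TypeB.moment_pos le_rfl _
  have hM : 0 < TypeB.moment 1 (m + 1) := TypeB.moment_pos zero_le_one _
  have hm' : (1 : ℝ) ≤ m := by exact_mod_cast hm
  have hl : 0 < Real.log ((m : ℝ) + 1) := Real.log_pos (by linarith)
  simp only [Pi.div_apply, TypeB.N_eq_expect, TypeB.M_eq_expect]
  change _ = TypeB.moment 0 (m + 1) / TypeB.moment 1 (m + 1) / _
  push_cast
  rw [← Real.exp_log (x := TypeB.moment 0 (m + 1) / TypeB.moment 1 (m + 1) / _) (by positivity),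
    Real.log_div (by positivity) (by positivity), Real.log_div hN.ne' hM.ne',
    Real.log_sqrt (by positivity), Real.log_div hl.ne' (by positivity)]
  congr 1
  ring
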